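/- For a finite simple graph $G$, a spanning tree of $G$ is a subgraph of $G$ that contains all vertices of $G$ and is a tree. For an integer $n\ge 3$, let $\alpha(n)$ be the least $k$ such that there is a simple graph with $k$ vertices having precisely $n$ spanning trees, and let $\beta(n)$ be the least $k$ such that there is a simple graph with $k$ edges having precisely $n$ spanning trees. (Both exist, since the $n$-cycle has exactly $n$ spanning trees.) Then $$\beta(9)=6,\qquad \alpha(18)=8,\qquad \alpha(25)=9,\qquad \beta(37)\le 9,\qquad \beta(58)\le 10,\qquad \beta(30)\le 8.$$ -/

import Mathlib

/-- The number of spanning trees of `G`: the number of subgraphs of `G` on the whole vertex set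
that are trees. (It is `0` for a disconnected graph and for the graph without vertices.) -/
noncomputable def numSpanningTrees {V : Type*} (G : SimpleGraph V) : ℕ :=
  {T : SimpleGraph V | T ≤ G ∧ T.IsTree}.ncard

/-- `alpha n` is the least `k` such that some simple graph with `k` vertices has precisely `n`
spanning trees; it is `⊤` if there is no such graph, so that an upper bound on `alpha n`
always asserts that a graph exists. -/
noncomputable def alpha (n : ℕ) : ℕ∞ :=
  sInf {κ : ℕ∞ | ∃ (k : ℕ) (G : SimpleGraph (Fin k)), numSpanningTrees G = n ∧ κ = k}

/-- `beta n` is the least `k` such that some finite simple graph with `k` edges has precisely `n`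
spanning trees; it is `⊤` if there is no such graph, so that an upper bound on `beta n`
always asserts that a graph exists. -/
noncomputable def beta (n : ℕ) : ℕ∞ :=
  sInf {κ : ℕ∞ | ∃ (v : ℕ) (G : SimpleGraph (Fin v)),
    numSpanningTrees G = n ∧ κ = G.edgeSet.ncard}

-- Upper bounds are witnessed by explicit graphs, whose spanning trees are counted by deletion and
-- contraction on an edge list (`numSpanningTrees_listGraph`).
--
-- The lower bounds on `alpha` rest on a verified exhaustive search over graphs with at most `M ≤ 8`
-- vertices (`numSpanningTrees_ne_of_fullSearch`). Deleting a leaf preserves the count, so leaves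
-- may be excluded. A connected leafless graph with at least two spanning trees grows from a cycle
-- by attaching paths that run through new vertices until they meet a vertex already reached,
-- possibly on the path itself; once all vertices are covered, only chords are added. No
-- intermediate count exceeds the final one (`EmbedsEdges.treeCount_le`), so a branch is dropped
-- once it passes `N`, and the search fails if `N` is hit.
--
-- For `6 ≤ beta 9` the search settles at most four vertices, and a binomial bound on the number of
-- edge sets settles the rest.

open SimpleGraph

-- Counting forests by deletion and contraction

/-- Identify the labels of the vertices `a` and `b`. -/
def mergeLabels (lab : ℕ → ℕ) (a b : ℕ) : ℕ → ℕ :=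
  fun i => if lab i = lab b then lab a else lab i

/-- The number of `n`-element subsets of the edge list `L` that are acyclic once vertices with
equal labels are identified. -/
def forestCount : List (ℕ × ℕ) → (ℕ → ℕ) → ℕ → ℕ
  | _, _, 0 => 1
  | [], _, _ + 1 => 0
  | e :: L, lab, n + 1 => forestCount L lab (n + 1) +
      if lab e.1 = lab e.2 then 0 else forestCount L (mergeLabels lab e.1 e.2) n

@[simp] lemma forestCount_zero (L : List (ℕ × ℕ)) (lab : ℕ → ℕ) : forestCount L lab 0 = 1 := by
  cases L <;> rfl

@[simp] lemma forestCount_nil_succ (lab : ℕ → ℕ) (n : ℕ) : forestCount [] lab (n + 1) = 0 := rfl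

lemma forestCount_cons_succ (e : ℕ × ℕ) (L : List (ℕ × ℕ)) (lab : ℕ → ℕ) (n : ℕ) :
    forestCount (e :: L) lab (n + 1) = forestCount L lab (n + 1) +
      if lab e.1 = lab e.2 then 0 else forestCount L (mergeLabels lab e.1 e.2) n := rfl

/-- `L` lists edges `(a, b)` with `a < b < k` without repetition. -/
structure ValidEdges (k : ℕ) (L : List (ℕ × ℕ)) : Prop where
  nodup : L.Nodup
  lt : ∀ e ∈ L, e.1 < e.2 ∧ e.2 < k

namespace ValidEdges

variable {k l : ℕ} {e : ℕ × ℕ} {L : List (ℕ × ℕ)}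

lemma tail (h : ValidEdges k (e :: L)) : ValidEdges k L :=
  ⟨h.nodup.of_cons, fun x hx => h.lt x (List.mem_cons_of_mem _ hx)⟩

lemma cons (h : ValidEdges k L) (he : e ∉ L) (h1 : e.1 < e.2) (h2 : e.2 < k) :
    ValidEdges k (e :: L) :=
  ⟨List.nodup_cons.2 ⟨he, h.nodup⟩, by
    intro x hx
    rcases List.mem_cons.1 hx with rfl | hx
    exacts [⟨h1, h2⟩, h.lt x hx]⟩

lemma mono (h : ValidEdges k L) (hkl : k ≤ l) : ValidEdges l L :=
  ⟨h.nodup, fun x hx => ⟨(h.lt x hx).1, (h.lt x hx).2.trans_le hkl⟩⟩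

lemma pendant (h : ValidEdges k L) {p : ℕ} (hp : p < k) : ValidEdges (k + 1) ((p, k) :: L) :=
  (h.mono k.le_succ).cons (fun hm => (h.lt _ hm).2.false) hp k.lt_succ_self

lemma fst_lt (h : ValidEdges k L) (he : e ∈ L) : e.1 < k := (h.lt e he).1.trans (h.lt e he).2

end ValidEdges

/-- Labels are only compared for equality, so the count depends on the partition they induce, not on
the names of its parts. -/
lemma forestCount_congr {k : ℕ} {L : List (ℕ × ℕ)} (hL : ValidEdges k L) :
    ∀ {lab lab' : ℕ → ℕ} (n : ℕ), (∀ i < k, ∀ j < k, lab i = lab j ↔ lab' i = lab' j) →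
      forestCount L lab n = forestCount L lab' n := by
  induction L with
  | nil => intro lab lab' n _; cases n <;> simp
  | cons e L ih =>
    intro lab lab' n h
    cases n with
    | zero => simp
    | succ n =>
      have h1 := hL.fst_lt (List.mem_cons_self)
      have h2 := (hL.lt e List.mem_cons_self).2
      rw [forestCount_cons_succ, forestCount_cons_succ, ih hL.tail (n + 1) h]
      congr 1
      refine if_congr (h _ h1 _ h2) rfl (ih hL.tail n fun i hi j hj => ?_)
      have := h i hi j hj
      have := h i hi _ h1
      have := h i hi _ h2
      have := h j hj _ h1
      have := h j hj _ h2
      have := h _ h1 _ h2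
      have := h _ h1 _ hj
      unfold mergeLabels
      grind

/-- Each chosen edge merges two label classes and at least one class survives, so a forest on `c`
classes has fewer than `c` edges. -/
lemma forestCount_eq_zero {k : ℕ} (hk : 0 < k) {L : List (ℕ × ℕ)} (hL : ValidEdges k L) :
    ∀ {lab : ℕ → ℕ} {n : ℕ}, ((Finset.range k).image lab).card ≤ n → forestCount L lab n = 0 := by
  have hpos : ∀ lab : ℕ → ℕ, 0 < ((Finset.range k).image lab).card := fun lab =>
    Finset.card_pos.2 ⟨lab 0, Finset.mem_image_of_mem _ (Finset.mem_range.2 hk)⟩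
  induction L with
  | nil =>
    intro lab n h
    obtain ⟨n, rfl⟩ := Nat.exists_eq_succ_of_ne_zero ((hpos lab).trans_le h).ne'
    rfl
  | cons e L ih =>
    intro lab n h
    obtain ⟨n, rfl⟩ := Nat.exists_eq_succ_of_ne_zero ((hpos lab).trans_le h).ne'
    have h1 := hL.fst_lt (List.mem_cons_self)
    have h2 := (hL.lt e List.mem_cons_self).2
    rw [forestCount_cons_succ, ih hL.tail h, zero_add]
    split_ifs with hab
    · rfl
    · apply ih hL.tail
      have hsub : (Finset.range k).image (mergeLabels lab e.1 e.2) ⊆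
          ((Finset.range k).image lab).erase (lab e.2) := by
        intro x hx
        obtain ⟨i, hi, rfl⟩ := Finset.mem_image.1 hx
        rw [Finset.mem_erase]
        unfold mergeLabels
        split_ifs with hi2
        · exact ⟨hab, Finset.mem_image_of_mem _ (Finset.mem_range.2 h1)⟩
        · exact ⟨hi2, Finset.mem_image_of_mem _ hi⟩
      have := Finset.card_le_card hsub
      rw [Finset.card_erase_of_mem (Finset.mem_image_of_mem _ (Finset.mem_range.2 h2))] at this
      have := hpos (mergeLabels lab e.1 e.2)
      omega

/-- The number of spanning trees of the graph on `0, …, k - 1` with edge list `L`. -/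
def treeCount (k : ℕ) (L : List (ℕ × ℕ)) : ℕ := forestCount L id (k - 1)

/-- The number of spanning trees of the graph on `0, …, k - 1` with edge list `L` in which the
vertices `u` and `y` are identified, and `0` for `u = y`. -/
def glueCount (k : ℕ) (L : List (ℕ × ℕ)) (u y : ℕ) : ℕ :=
  if u = y then 0 else forestCount L (mergeLabels id u y) (k - 2)

lemma glueCount_comm {k : ℕ} {L : List (ℕ × ℕ)} (hL : ValidEdges k L) (u y : ℕ) :
    glueCount k L u y = glueCount k L y u := by
  unfold glueCount
  refine if_congr eq_comm rfl (forestCount_congr hL _ fun i _ j _ => ?_)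
  simp only [mergeLabels, id]
  grind

/-- Without the pendant edge, `k` edges would have to form a forest on `k` vertices. Contracting it
changes only the label of `k`, which `L` never meets. -/
lemma treeCount_pendant {k : ℕ} {L : List (ℕ × ℕ)} (hL : ValidEdges k L) {p : ℕ} (hp : p < k) :
    treeCount (k + 1) ((p, k) :: L) = treeCount k L := by
  obtain ⟨m, rfl⟩ := Nat.exists_eq_succ_of_ne_zero (Nat.ne_zero_of_lt hp)
  unfold treeCount
  simp only [Nat.succ_eq_add_one, Nat.add_sub_cancel]
  rw [forestCount_cons_succ, forestCount_eq_zero (Nat.succ_pos m) hL (by simp), zero_add,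
    if_neg (by simp only [id]; omega)]
  refine forestCount_congr hL _ fun i hi j hj => ?_
  simp only [mergeLabels, id]
  grind

lemma treeCount_cons {k a b : ℕ} (L : List (ℕ × ℕ)) (hab : a < b) (hb : b < k) :
    treeCount k ((a, b) :: L) = treeCount k L + glueCount k L a b := by
  obtain ⟨m, rfl⟩ := Nat.exists_eq_add_of_le' (show 2 ≤ k by omega)
  unfold treeCount glueCount
  rw [if_neg hab.ne, show m + 2 - 1 = m + 1 by omega, forestCount_cons_succ,
    if_neg (by simpa using hab.ne)]
  rfl

/-- Gluing `k` to `y` turns the pendant edge into a chord from `p` to `y`, a loop if `p = y`. This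
lets glue counts be updated along a growing path without recounting. -/
lemma glueCount_pendant {k : ℕ} {L : List (ℕ × ℕ)} (hL : ValidEdges k L) {p y : ℕ} (hp : p < k)
    (hy : y < k) :
    glueCount (k + 1) ((p, k) :: L) y k = treeCount k L + glueCount k L p y := by
  have hcongr : ∀ n, forestCount L (mergeLabels id y k) n = forestCount L id n := fun n =>
    forestCount_congr hL n fun i hi j hj => by
      simp only [mergeLabels, id]
      grind
  unfold glueCount treeCount
  rw [if_neg hy.ne, show k + 1 - 2 = k - 1 by omega]
  rcases eq_or_ne p y with rfl | hpy
  · rw [if_pos rfl, add_zero, ← hcongr]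
    cases hk : k - 1 with
    | zero => simp
    | succ m =>
      rw [forestCount_cons_succ, if_pos (by simp [mergeLabels]), add_zero]
  · rw [if_neg hpy]
    obtain ⟨m, rfl⟩ := Nat.exists_eq_add_of_le' (show 2 ≤ k by omega)
    rw [show m + 2 - 1 = m + 1 by omega, forestCount_cons_succ, hcongr,
      if_neg (by simp only [mergeLabels, id]; grind)]
    congr 1
    refine forestCount_congr hL _ fun i hi j hj => ?_
    simp only [mergeLabels, id]
    grind

-- From edge lists to spanning trees of graphs

section Semantics

variable {V : Type*}

lemma reachable_sup_edge_iff {F : SimpleGraph V} {a b x y : V} :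
    (F ⊔ edge a b).Reachable x y ↔ F.Reachable x y ∨ (F.Reachable x a ∧ F.Reachable b y) ∨
      (F.Reachable x b ∧ F.Reachable a y) := by
  constructor
  · intro h
    rw [reachable_iff_reflTransGen] at h
    induction h with
    | refl => exact .inl .rfl
    | tail _ hyz ih =>
      rename_i y z _
      rw [sup_adj, edge_adj] at hyz
      have tr := fun u v w => @Reachable.trans _ F u v w
      rcases hyz with hyz | ⟨⟨rfl, rfl⟩ | ⟨rfl, rfl⟩, _⟩
      · have := hyz.reachable
        grind
      · have := Reachable.refl (G := F) z
        have sy := fun u v => @Reachable.symm _ F u v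
        grind
      · have := Reachable.refl (G := F) z
        have sy := fun u v => @Reachable.symm _ F u v
        grind
  · have hab : (F ⊔ edge a b).Reachable a b := by
      by_cases h : a = b
      · rw [h]
      · exact Adj.reachable (by simp [edge_adj, h])
    have mono : ∀ {u v}, F.Reachable u v → (F ⊔ edge a b).Reachable u v :=
      fun h => h.mono le_sup_left
    rintro (h | ⟨h, h'⟩ | ⟨h, h'⟩)
    · exact mono h
    · exact (mono h).trans (hab.trans (mono h'))
    · exact (mono h).trans (hab.symm.trans (mono h'))

/-- The graph on `V` whose edges are the images of the pairs in `L`. -/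
def listGraph (φ : ℕ → V) (L : List (ℕ × ℕ)) : SimpleGraph V :=
  fromEdgeSet {s | ∃ e ∈ L, s = s(φ e.1, φ e.2)}

lemma listGraph_nil (φ : ℕ → V) : listGraph φ [] = ⊥ := by
  simp [listGraph]

lemma listGraph_cons (φ : ℕ → V) (e : ℕ × ℕ) (L : List (ℕ × ℕ)) :
    listGraph φ (e :: L) = edge (φ e.1) (φ e.2) ⊔ listGraph φ L := by
  rw [listGraph, listGraph, edge, ← fromEdgeSet_union]
  congr 1
  ext s
  simp

lemma listGraph_adj {φ : ℕ → V} {L : List (ℕ × ℕ)} {x y : V} :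
    (listGraph φ L).Adj x y ↔ (∃ e ∈ L, s(x, y) = s(φ e.1, φ e.2)) ∧ x ≠ y := by
  rw [listGraph, fromEdgeSet_adj]
  rfl

lemma sym2_map_eq_iff {k : ℕ} {φ : ℕ → V} (hφ : Set.InjOn φ (Set.Iio k)) {e e' : ℕ × ℕ}
    (he : e.1 < e.2 ∧ e.2 < k) (he' : e'.1 < e'.2 ∧ e'.2 < k) :
    s(φ e.1, φ e.2) = s(φ e'.1, φ e'.2) ↔ e = e' := by
  have inj : ∀ {i j}, i < k → j < k → (φ i = φ j ↔ i = j) := fun hi hj => hφ.eq_iff hi hj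
  rw [Sym2.eq_iff, inj (he.1.trans he.2) (he'.1.trans he'.2), inj he.2 he'.2,
    inj (he.1.trans he.2) he'.2, inj he.2 (he'.1.trans he'.2), Prod.ext_iff]
  omega

variable [Finite V]

lemma eq_of_le_of_ncard_le {F T : SimpleGraph V} (h : F ≤ T)
    (hc : T.edgeSet.ncard ≤ F.edgeSet.ncard) : T = F :=
  (edgeSet_injective (Set.eq_of_subset_of_ncard_le (edgeSet_mono h) hc)).symm

lemma ncard_edgeSet_sup_edge {F : SimpleGraph V} {a b : V} (hab : a ≠ b) (h : ¬ F.Adj a b) :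
    (F ⊔ edge a b).edgeSet.ncard = F.edgeSet.ncard + 1 := by
  rw [edgeSet_sup, edgeSet_edge_of_ne hab, Set.union_singleton,
    Set.ncard_insert_of_notMem (by simpa using h)]

/-- The forests between `F` and `F ⊔ H` that have `n` edges more than `F`. -/
def forestsBetween (F H : SimpleGraph V) (n : ℕ) : Set (SimpleGraph V) :=
  {T | F ≤ T ∧ T ≤ F ⊔ H ∧ T.IsAcyclic ∧ T.edgeSet.ncard = F.edgeSet.ncard + n}

/-- `F` holds the edges chosen so far and `lab` names its components, so contracting an edge means
adding it to `F`. -/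
lemma ncard_forestsBetween {k : ℕ} {φ : ℕ → V} (hφ : Set.InjOn φ (Set.Iio k))
    {L : List (ℕ × ℕ)} (hL : ValidEdges k L) :
    ∀ {F : SimpleGraph V} {lab : ℕ → ℕ} (n : ℕ), F.IsAcyclic →
      (∀ i < k, ∀ j < k, F.Reachable (φ i) (φ j) ↔ lab i = lab j) →
      (forestsBetween F (listGraph φ L) n).ncard = forestCount L lab n := by
  have zero : ∀ (F H : SimpleGraph V), F.IsAcyclic → (forestsBetween F H 0).ncard = 1 := by
    intro F H hF
    rw [Set.ncard_eq_one]
    refine ⟨F, Set.ext fun T => ⟨fun h => eq_of_le_of_ncard_le h.1 h.2.2.2.le, ?_⟩⟩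
    rintro rfl
    exact ⟨le_rfl, le_sup_left, hF, rfl⟩
  induction L with
  | nil =>
    intro F lab n hF hlab
    cases n with
    | zero => rw [zero F _ hF, forestCount_zero]
    | succ n =>
      rw [forestCount_nil_succ, listGraph_nil, Set.ncard_eq_zero]
      refine Set.eq_empty_of_forall_notMem fun T h => ?_
      have := le_antisymm h.1 (by simpa using h.2.1)
      have h3 := h.2.2.2
      rw [← this] at h3
      omega
  | cons e L ih =>
    intro F lab n hF hlab
    have h2 := hL.lt e List.mem_cons_self
    have h1 := hL.fst_lt (List.mem_cons_self (a := e) (l := L))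
    have hne : φ e.1 ≠ φ e.2 := fun h => h2.1.ne (hφ h1 h2.2 h)
    cases n with
    | zero => rw [zero F _ hF, forestCount_zero]
    | succ n =>
      rw [forestCount_cons_succ, ← ih hL.tail (n + 1) hF hlab, listGraph_cons]
      have hmem : ∀ {T}, T ∈ forestsBetween F (edge (φ e.1) (φ e.2) ⊔ listGraph φ L) (n + 1) →
          ¬ T.Adj (φ e.1) (φ e.2) ∨ F.Adj (φ e.1) (φ e.2) →
          T ∈ forestsBetween F (listGraph φ L) (n + 1) := by
        rintro T ⟨hFT, hT, hac, hc⟩ h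
        refine ⟨hFT, fun x y hxy => ?_, hac, hc⟩
        have h' := hT hxy
        rw [sup_adj, sup_adj, edge_adj] at h'
        rw [sup_adj]
        rcases h' with h' | ⟨⟨rfl, rfl⟩ | ⟨rfl, rfl⟩, _⟩ | h'
        · exact .inl h'
        · exact h.elim (fun h => absurd hxy h) .inl
        · exact h.elim (fun h => absurd hxy.symm h) fun h => .inl h.symm
        · exact .inr h'
      have hmem' : ∀ {T}, T ∈ forestsBetween F (listGraph φ L) (n + 1) →
          T ∈ forestsBetween F (edge (φ e.1) (φ e.2) ⊔ listGraph φ L) (n + 1) := fun h =>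
        ⟨h.1, h.2.1.trans (sup_le_sup_left le_sup_right _), h.2.2⟩
      split_ifs with hab
      -- The ends of `e` are already joined in `F`, so a forest above `F` contains `e` only if `F`
      -- does: offering `e` adds nothing.
      · rw [add_zero]
        congr 1
        refine Set.ext fun T => ⟨fun h => hmem h ?_, hmem'⟩
        by_contra! hcon
        have hle : F ⊔ edge (φ e.1) (φ e.2) ≤ T := sup_le h.1 ((edge_le_iff _).2 (.inr hcon.1))
        rcases (isAcyclic_sup_fromEdgeSet_iff.1 (h.2.2.1.anti hle)).2 ((hlab _ h1 _ h2.2).2 hab)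
          with h | h
        exacts [hne h, hcon.2 h]
      · have hnr : ¬ F.Reachable (φ e.1) (φ e.2) := fun h => hab ((hlab _ h1 _ h2.2).1 h)
        have hna : ¬ F.Adj (φ e.1) (φ e.2) := fun h => hnr h.reachable
        have hnL : ¬ (listGraph φ L).Adj (φ e.1) (φ e.2) := by
          rw [listGraph_adj]
          rintro ⟨⟨e', he', h⟩, -⟩
          rw [sym2_map_eq_iff hφ h2 (hL.tail.lt e' he')] at h
          exact (List.nodup_cons.1 hL.nodup).1 (h ▸ he')
        rw [← ih hL.tail (F := F ⊔ edge (φ e.1) (φ e.2)) n (hF.sup_edge_of_not_reachable hnr)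
          (lab := mergeLabels lab e.1 e.2) ?_, ← Set.ncard_union_eq]
        · congr 1
          refine Set.ext fun T => ⟨fun h => ?_, ?_⟩
          · by_cases hT : T.Adj (φ e.1) (φ e.2)
            · refine .inr ⟨sup_le h.1 ((edge_le_iff _).2 (.inr hT)), ?_, h.2.2.1, ?_⟩
              · rw [sup_assoc]; exact h.2.1
              · rw [ncard_edgeSet_sup_edge hne hna, h.2.2.2]; ring
            · exact .inl (hmem h (.inl hT))
          · rintro (h | ⟨hF', hT, hac, hc⟩)
            · exact hmem' h
            · refine ⟨le_sup_left.trans hF', by rwa [← sup_assoc], hac, ?_⟩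
              rw [hc, ncard_edgeSet_sup_edge hne hna]; ring
        · rw [Set.disjoint_left]
          intro T h h'
          have : T.Adj (φ e.1) (φ e.2) :=
            h'.1 (by simp [edge_adj, hne])
          rcases h.2.1 this with h | h
          exacts [hna h, hnL h]
        · intro i hi j hj
          rw [reachable_sup_edge_iff, hlab i hi j hj, hlab i hi _ h1, hlab i hi _ h2.2,
            hlab _ h1 j hj, hlab _ h2.2 j hj]
          unfold mergeLabels
          grind

/-- An acyclic graph extends to a spanning tree of the complete graph, and the edge count forces
equality. -/
lemma isTree_iff_isAcyclic_and_ncard [Nonempty V] {T : SimpleGraph V} :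
    T.IsTree ↔ T.IsAcyclic ∧ T.edgeSet.ncard + 1 = Nat.card V := by
  refine ⟨fun h => ⟨h.isAcyclic, (isTree_iff_connected_and_card.1 h).2⟩, fun ⟨h, hc⟩ => ?_⟩
  obtain ⟨T', hle, -, hT'⟩ := connected_top.exists_isTree_le_of_le_of_isAcyclic le_top h
  have h2 : T'.edgeSet.ncard + 1 = Nat.card V := (isTree_iff_connected_and_card.1 hT').2
  rwa [← eq_of_le_of_ncard_le hle (by omega)]

lemma numSpanningTrees_listGraph {k : ℕ} {φ : ℕ → V} (hφ : Set.InjOn φ (Set.Iio k))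
    (hsurj : ∀ x, ∃ i < k, φ i = x) {L : List (ℕ × ℕ)} (hL : ValidEdges k L) (hk : 0 < k) :
    numSpanningTrees (listGraph φ L) = treeCount k L := by
  have : Nonempty V := ⟨φ 0⟩
  have hcard : Nat.card V = k := by
    have : φ '' Set.Iio k = Set.univ := Set.eq_univ_of_forall fun x => hsurj x
    rw [← Set.ncard_univ, ← this, hφ.ncard_image, Set.ncard_eq_toFinset_card', Set.toFinset_Iio, Nat.card_Iio]
  rw [treeCount, ← ncard_forestsBetween hφ hL (F := ⊥) (k - 1) isAcyclic_bot
    (lab := id) (fun i hi j hj => by rw [reachable_bot, id, id]; exact hφ.eq_iff hi hj)]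
  unfold numSpanningTrees
  congr 1
  ext T
  simp only [forestsBetween, Set.mem_ofPred_eq, isTree_iff_isAcyclic_and_ncard, hcard, bot_le,
    true_and, bot_sup_eq, edgeSet_bot, Set.ncard_empty]
  refine and_congr_right fun _ => and_congr_right fun _ => ?_
  omega

end Semantics

-- The executable search

/-- A partition of `0, …, 7` is coded by the number whose bit `8 * i + j` says whether `i` and `j`
lie in the same part. This merges the parts of `a` and `b`. -/
def mergeBits (X a b : ℕ) : ℕ :=
  Nat.lor X (Nat.lor
    (Nat.mul (Nat.land (Nat.shiftRight X (Nat.mul 8 a)) 255)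
      (Nat.land (Nat.shiftRight X b) 0x0101010101010101))
    (Nat.mul (Nat.land (Nat.shiftRight X (Nat.mul 8 b)) 255)
      (Nat.land (Nat.shiftRight X a) 0x0101010101010101)))

/-- Adds `forestCount` to `acc`, stopping when the sum exceeds `c`. -/
def cappedCount (c : ℕ) : List (ℕ × ℕ) → ℕ → ℕ → ℕ → ℕ
  | [], _, n, acc => bif Nat.beq n 0 then Nat.succ acc else acc
  | e :: L, X, n, acc =>
    bif Nat.ble (Nat.succ c) acc then acc
    else bif Nat.beq n 0 then Nat.succ acc
    else bif Nat.beq 1 (Nat.land 1 (Nat.shiftRight X (Nat.add (Nat.mul 8 e.1) e.2))) then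
      cappedCount c L X n acc
    else cappedCount c L X n (cappedCount c L (mergeBits X e.1 e.2) (Nat.pred n) acc)

/-- The code of the partition of `0, …, 7` into singletons. -/
def discreteBits : ℕ := 0x8040201008040201

/-- A lower bound for `glueCount k L u y`, sharp if it is at most `c`. -/
def cappedGlue (c k : ℕ) (L : List (ℕ × ℕ)) (u y : ℕ) : ℕ :=
  bif Nat.beq u y then 0 else cappedCount c L (mergeBits discreteBits u y) (k - 2) 0

/-- Whether no graph arising from `L`, with `t` spanning trees, by adding edges from the first list
has `N` spanning trees. -/
def chordSearch (N k : ℕ) : List (ℕ × ℕ) → List (ℕ × ℕ) → ℕ → Bool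
  | [], _, _ => true
  | e :: C, L, t => chordSearch N k C L t &&
      (fun d => Nat.ble (N + 1) d || (!Nat.beq d N && chordSearch N k C (e :: L) d))
        (t + cappedGlue (N - t) k L e.1 e.2)

/-- The pairs `(a, b)` with `a < b < k`. -/
def allPairs (k : ℕ) : List (ℕ × ℕ) :=
  (List.range k).flatMap fun v => (List.range v).map fun u => (u, v)

/-- `chordSearch` for all edges that are not in `L`. -/
def fillSearch (N k : ℕ) (L : List (ℕ × ℕ)) (t : ℕ) : Bool :=
  chordSearch N k ((allPairs k).filter fun e => !L.contains e) L t

/-- The numbers `glueCount k L u y` for `y < k`, as far as they matter for graphs with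
`2 * t + glueCount k L u y` spanning trees. -/
def glueList (N k : ℕ) (L : List (ℕ × ℕ)) (t u : ℕ) : List ℕ :=
  (List.range k).map fun y =>
    bif Nat.ble (N + 1) (2 * t) then 0 else cappedGlue (N - 2 * t) k L u y

mutual

/-- Continues a path that has left the graph `L` on `0, …, k - 1`, with `t` spanning trees, at `p`
and has reached the vertex `k`. -/
def pathSearch (N M : ℕ) : ℕ → ℕ → ℕ → ℕ → List (ℕ × ℕ) → ℕ → List ℕ → Bool
  | 0, _, _, _, _, _, _ => false
  | f + 1, u₀, k, p, L, t, ds =>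
    (bif Nat.ble (k + 2) M then
      pathSearch N M f u₀ (k + 1) k ((p, k) :: L) t (ds.map (t + ·) ++ [0]) else true) &&
    (List.range k).all fun y => Nat.blt y u₀ || (Nat.beq y p ||
      (fun d => Nat.ble (N + 1) d || (!Nat.beq d N &&
        graphSearch N M f u₀ (k + 1) ((y, k) :: (p, k) :: L) d)) (2 * t + ds.getD y 0))

/-- Whether no graph without leaves on at most `M` vertices that arises from the graph `L` on
`0, …, k - 1`, with `t` spanning trees, has `N` spanning trees, if no vertex below `u₀` gets new
neighbours other than `0, …, k - 1`. -/
def graphSearch (N M : ℕ) : ℕ → ℕ → ℕ → List (ℕ × ℕ) → ℕ → Bool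
  | 0, _, _, _, _ => false
  | f + 1, u₀, k, L, t =>
    (bif Nat.ble (k + 1) M then (List.range k).all fun u => Nat.blt u u₀ ||
      pathSearch N M f u k u L t (glueList N k L t u) else true) && fillSearch N k L t

end

/-- The edges of the cycle on `0, …, m - 1`. -/
def cycleEdges (m : ℕ) : List (ℕ × ℕ) := (0, m - 1) :: (List.range (m - 1)).map fun i => (i, i + 1)

/-- `graphSearch` started at a cycle, where the first path may be assumed to leave at `0`. -/
def cycleSearch (N M f m : ℕ) : Bool :=
  (fun t => Nat.ble (N + 1) t || (!Nat.beq t N &&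
    ((bif Nat.ble (m + 1) M then
      pathSearch N M f 0 m 0 (cycleEdges m) t (glueList N m (cycleEdges m) t 0) else true) &&
    fillSearch N m (cycleEdges m) t))) (cappedCount N (cycleEdges m) discreteBits (m - 1) 0)

/-- `cycleSearch` for all lengths of the cycle. -/
def fullSearch (N M f : ℕ) : Bool :=
  (List.range (M + 1)).all fun m => Nat.blt m 3 || cycleSearch N M f m

-- Correctness of the bit-coded counts

/-- The bits of `X` code the kernel of `lab` on `0, …, 7`. -/
def CodesLabels (X : ℕ) (lab : ℕ → ℕ) : Prop :=
  ∀ i < 8, ∀ j < 8, X.testBit (8 * i + j) = decide (lab i = lab j)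

lemma codesLabels_discreteBits : CodesLabels discreteBits id := by
  unfold CodesLabels
  decide

/-- As `c` has bits only at multiples of 8 and `r` fits in a byte, the product has no carries: byte
`i` is `r` or `0` according to bit `8 * i` of `c`. -/
lemma testBit_mul_of_dvd {r : ℕ} (hr : r < 256) {j : ℕ} (hj : j < 8) (i : ℕ) :
    ∀ c : ℕ, (∀ n, c.testBit n = true → 8 ∣ n) →
      (r * c).testBit (8 * i + j) = (r.testBit j && c.testBit (8 * i)) := by
  have key : ∀ c : ℕ, (∀ n, c.testBit n = true → 8 ∣ n) → c % 2 ^ 8 < 2 := by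
    intro c hc
    have h : ∀ b < 2 ^ 8, (∀ n < 8, 1 ≤ n → b.testBit n = false) → b < 2 := by decide +kernel
    refine h _ (Nat.mod_lt _ (by norm_num)) fun n hn hn' => ?_
    rw [Nat.testBit_mod_two_pow]
    by_contra hcon
    have := hc n (by simpa [hn] using hcon)
    omega
  have expand : ∀ c : ℕ, r * c = 2 ^ 8 * (r * (c / 2 ^ 8)) + r * (c % 2 ^ 8) := by
    intro c
    conv_lhs => rw [← Nat.div_add_mod c (2 ^ 8)]
    ring
  induction i with
  | zero =>
    intro c hc
    have hb := key c hc
    have hlt : r * (c % 2 ^ 8) < 2 ^ 8 := by nlinarith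
    rw [expand, Nat.testBit_two_pow_mul_add _ hlt, if_pos (by omega), mul_zero, zero_add]
    have h0 : c.testBit 0 = (c % 2 ^ 8).testBit 0 := by simp
    rw [h0]
    generalize c % 2 ^ 8 = b at hb
    interval_cases b <;> simp
  | succ i ih =>
    intro c hc
    have hb := key c hc
    have hlt : r * (c % 2 ^ 8) < 2 ^ 8 := by nlinarith
    rw [expand, Nat.testBit_two_pow_mul_add _ hlt, if_neg (by omega),
      show 8 * (i + 1) + j - 8 = 8 * i + j by omega, ih, Nat.testBit_div_two_pow]
    · congr 2
    · intro n hn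
      rw [Nat.testBit_div_two_pow] at hn
      have := hc _ hn
      omega

lemma mergeBits_eq (X a b : ℕ) : mergeBits X a b = X ||| ((((X >>> (8 * a)) &&& 255) *
    ((X >>> b) &&& 0x0101010101010101)) ||| (((X >>> (8 * b)) &&& 255) *
    ((X >>> a) &&& 0x0101010101010101))) := by
  unfold mergeBits
  rfl

/-- Byte `a` of `X` is the class of `a`, and the masked shift by `b` marks the rows in the class of
`b`. The two products fill the two rectangles between these classes. -/
lemma CodesLabels.merge {X : ℕ} {lab : ℕ → ℕ} (h : CodesLabels X lab) {a b : ℕ} (ha : a < 8)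
    (hb : b < 8) : CodesLabels (mergeBits X a b) (mergeLabels lab a b) := by
  have hcm : ∀ n, (0x0101010101010101 : ℕ).testBit n = true → 8 ∣ n := by
    intro n hn
    by_cases hn' : n < 64
    · have : ∀ n < 64, (0x0101010101010101 : ℕ).testBit n = true → 8 ∣ n := by decide +kernel
      exact this n hn' hn
    · rw [Nat.testBit_lt_two_pow] at hn
      · simp at hn
      · exact lt_of_lt_of_le (b := 2 ^ 64) (by norm_num) (Nat.pow_le_pow_right (by norm_num) (by omega))
  have hcm' : ∀ i < 8, (0x0101010101010101 : ℕ).testBit (8 * i) = true := by decide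
  have h255 : ∀ j < 8, (255 : ℕ).testBit j = true := by decide
  have prod : ∀ u < 8, ∀ v < 8, ∀ i < 8, ∀ j < 8,
      (((X >>> (8 * u)) &&& 255) * ((X >>> v) &&& 0x0101010101010101)).testBit (8 * i + j) =
        (decide (lab u = lab j) && decide (lab i = lab v)) := by
    intro u hu v hv i hi j hj
    rw [testBit_mul_of_dvd (lt_of_le_of_lt Nat.and_le_right (by norm_num)) hj]
    · rw [Nat.testBit_and, Nat.testBit_and, hcm' i hi, h255 j hj, Nat.testBit_shiftRight,
        Nat.testBit_shiftRight, h u hu j hj, add_comm v, h i hi v hv, Bool.and_true, Bool.and_true]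
    · intro n hn
      rw [Nat.testBit_and, Bool.and_eq_true] at hn
      exact hcm n hn.2
  intro i hi j hj
  rw [mergeBits_eq, Nat.testBit_or, Nat.testBit_or, prod a ha b hb i hi j hj, prod b hb a ha i hi j hj,
    h i hi j hj, Bool.eq_iff_iff]
  simp only [Bool.or_eq_true, Bool.and_eq_true, decide_eq_true_eq, mergeLabels]
  clear prod h255 hcm' hcm h
  grind

lemma beq_succ_zero (n : ℕ) : Nat.beq (n + 1) 0 = false := rfl

/-- Stopping early can only undercount, and happens only above `c`; pruning needs no more. -/
lemma cappedCount_spec (c : ℕ) {L : List (ℕ × ℕ)} (hL : ValidEdges 8 L) :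
    ∀ {X : ℕ} {lab : ℕ → ℕ} (n acc : ℕ), CodesLabels X lab →
      cappedCount c L X n acc ≤ acc + forestCount L lab n ∧
        (cappedCount c L X n acc ≤ c → cappedCount c L X n acc = acc + forestCount L lab n) := by
  induction L with
  | nil =>
    intro X lab n acc _
    cases n <;> simp [cappedCount, beq_succ_zero]
  | cons e L ih =>
    intro X lab n acc hX
    have h2 := (hL.lt e List.mem_cons_self).2
    have h1 := hL.fst_lt (List.mem_cons_self (a := e) (l := L))
    rw [cappedCount]
    cases hc : Nat.ble (Nat.succ c) acc with
    | true =>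
      have := Nat.le_of_ble_eq_true hc
      simp only [cond_true]
      omega
    | false =>
      cases n with
      | zero => simp
      | succ n =>
        have hbit : Nat.beq 1 (Nat.land 1 (Nat.shiftRight X (Nat.add (Nat.mul 8 e.1) e.2))) =
            decide (lab e.1 = lab e.2) := by
          rw [← hX _ h1 _ h2, Nat.testBit, Bool.eq_iff_iff, Nat.beq_eq]
          change 1 = 1 &&& (X >>> (8 * e.1 + e.2)) ↔ _
          rw [Nat.one_and_eq_mod_two]
          simp
          omega
        rw [hbit, forestCount_cons_succ]
        by_cases hab : lab e.1 = lab e.2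
        · simpa [hab, beq_succ_zero] using ih hL.tail (n + 1) acc hX
        · simp only [hab, cond_false, decide_false, if_false, Nat.pred_succ,
            beq_succ_zero]
          have s := ih hL.tail n acc (hX.merge h1 h2)
          have s' := ih hL.tail (n + 1) (cappedCount c L (mergeBits X e.1 e.2) n acc) hX
          omega

lemma cappedGlue_spec (c : ℕ) {k : ℕ} (hk : k ≤ 8) {L : List (ℕ × ℕ)} (hL : ValidEdges k L)
    {u y : ℕ} (hu : u < k) (hy : y < k) :
    cappedGlue c k L u y ≤ glueCount k L u y ∧
      (cappedGlue c k L u y ≤ c → cappedGlue c k L u y = glueCount k L u y) := by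
  unfold cappedGlue glueCount
  rcases eq_or_ne u y with rfl | h
  · simp
  · have hb : Nat.beq u y = false := by
      rw [Bool.eq_false_iff]
      exact fun h' => h (Nat.eq_of_beq_eq_true h')
    rw [hb, if_neg h]
    simpa using cappedCount_spec c (hL.mono hk) (k - 2) 0
      (codesLabels_discreteBits.merge (hu.trans_le hk) (hy.trans_le hk))

-- Embedded subgraphs and monotonicity of the count

section Embedding

variable {V : Type*} {G : SimpleGraph V} {k : ℕ} {L : List (ℕ × ℕ)} {φ : ℕ → V}

/-- `φ` embeds the graph on `0, …, k - 1` with edge list `L` into `G`. -/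
structure EmbedsEdges (G : SimpleGraph V) (k : ℕ) (L : List (ℕ × ℕ)) (φ : ℕ → V) : Prop where
  injOn : Set.InjOn φ (Set.Iio k)
  adj : ∀ e ∈ L, G.Adj (φ e.1) (φ e.2)

lemma EmbedsEdges.cons (h : EmbedsEdges G k L φ) {a b : ℕ} (hab : G.Adj (φ a) (φ b)) :
    EmbedsEdges G k ((a, b) :: L) φ :=
  ⟨h.injOn, by
    intro e he
    rcases List.mem_cons.1 he with rfl | he
    exacts [hab, h.adj e he]⟩

lemma EmbedsEdges.pendant (h : EmbedsEdges G k L φ) (hL : ValidEdges k L) {p : ℕ} (hp : p < k)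
    {x : V} (hx : x ∉ φ '' Set.Iio k) (hpx : G.Adj (φ p) x) :
    EmbedsEdges G (k + 1) ((p, k) :: L) (Function.update φ k x) := by
  have hup : ∀ i < k, Function.update φ k x i = φ i := fun i hi =>
    Function.update_of_ne hi.ne _ _
  refine EmbedsEdges.cons ⟨?_, fun e he => ?_⟩ ?_
  · intro i hi j hj hij
    simp only [Set.mem_Iio] at hi hj
    rcases Nat.lt_succ_iff_lt_or_eq.1 hi with hi | rfl <;>
      rcases Nat.lt_succ_iff_lt_or_eq.1 hj with hj | rfl
    · rw [hup i hi, hup j hj] at hij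
      exact h.injOn hi hj hij
    · rw [hup i hi, Function.update_self] at hij
      exact absurd ⟨i, hi, hij⟩ hx
    · rw [hup j hj, Function.update_self] at hij
      exact absurd ⟨j, hj, hij.symm⟩ hx
    · rfl
  · rw [hup _ (hL.fst_lt he), hup _ (hL.lt e he).2]
    exact h.adj e he
  · rwa [hup p hp, Function.update_self]

lemma image_congr_update (φ : ℕ → V) (k : ℕ) (x : V) :
    Function.update φ k x '' Set.Iio k = φ '' Set.Iio k :=
  Set.image_congr fun _ hi => Function.update_of_ne (ne_of_lt hi) _ _

lemma EmbedsEdges.card_le [Finite V] (h : EmbedsEdges G k L φ) : k ≤ Nat.card V := by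
  rw [← Set.ncard_univ]
  calc k = (φ '' Set.Iio k).ncard := by
        rw [h.injOn.ncard_image, Set.ncard_eq_toFinset_card', Set.toFinset_Iio, Nat.card_Iio]
    _ ≤ _ := Set.ncard_le_ncard (Set.subset_univ _)

lemma EmbedsEdges.eq_listGraph (h : EmbedsEdges G k L φ) (hs : ∀ x, ∃ i < k, φ i = x)
    (hG : ∀ a b, a < b → b < k → G.Adj (φ a) (φ b) → (a, b) ∈ L) : G = listGraph φ L := by
  ext x y
  rw [listGraph_adj]
  constructor
  · intro hxy
    refine ⟨?_, hxy.ne⟩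
    obtain ⟨a, ha, rfl⟩ := hs x
    obtain ⟨b, hb, rfl⟩ := hs y
    rcases lt_trichotomy a b with hab | rfl | hab
    · exact ⟨_, hG a b hab hb hxy, rfl⟩
    · exact absurd hxy (G.loopless.irrefl _)
    · exact ⟨_, hG b a hab ha hxy.symm, Sym2.eq_swap⟩
  · rintro ⟨⟨e, he, hxy⟩, -⟩
    rw [← mem_edgeSet, hxy]
    exact h.adj e he

lemma ncard_edgeSet_listGraph [Finite V] (hφ : Set.InjOn φ (Set.Iio k)) (hL : ValidEdges k L) :
    (listGraph φ L).edgeSet.ncard = L.length := by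
  induction L with
  | nil => simp [listGraph_nil]
  | cons e L ih =>
    have h2 := hL.lt e List.mem_cons_self
    have h1 := hL.fst_lt (List.mem_cons_self (a := e) (l := L))
    rw [listGraph_cons, sup_comm, ncard_edgeSet_sup_edge (fun h => h2.1.ne (hφ h1 h2.2 h)),
      ih hL.tail, List.length_cons]
    rw [listGraph_adj]
    rintro ⟨⟨e', he', h⟩, -⟩
    rw [sym2_map_eq_iff hφ h2 (hL.tail.lt e' he')] at h
    exact (List.nodup_cons.1 hL.nodup).1 (h ▸ he')

lemma EmbedsEdges.length_le [Finite V] (h : EmbedsEdges G k L φ) (hL : ValidEdges k L) :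
    L.length ≤ G.edgeSet.ncard := by
  rw [← ncard_edgeSet_listGraph h.injOn hL]
  refine Set.ncard_le_ncard (edgeSet_mono fun x y hxy => ?_)
  obtain ⟨⟨e, he, hxy⟩, -⟩ := listGraph_adj.1 hxy
  rw [← mem_edgeSet, hxy]
  exact h.adj e he

lemma exists_adj_notMem_image (hG : G.Connected) (hk : 0 < k) (hs : ¬ ∀ x, ∃ i < k, φ i = x) :
    ∃ u < k, ∃ x ∉ φ '' Set.Iio k, G.Adj (φ u) x := by
  push Not at hs
  obtain ⟨x, hx⟩ := hs
  obtain ⟨w⟩ := hG.preconnected (φ 0) x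
  obtain ⟨d, -, ⟨u, hu, hu'⟩, hd⟩ := w.exists_boundary_dart (φ '' Set.Iio k) ⟨0, hk, rfl⟩
    fun ⟨i, hi, h⟩ => hx i hi h
  exact ⟨u, hu, _, hd, hu' ▸ d.adj⟩

/-- The embedded graph grows to `G` by pendant vertices, which keep the count, and chords, which add
a glue count. The induction is on the number of missing edges. -/
lemma EmbedsEdges.treeCount_le [Finite V] (hG : G.Connected) :
    ∀ {k : ℕ} {L : List (ℕ × ℕ)} {φ : ℕ → V}, 0 < k → ValidEdges k L → EmbedsEdges G k L φ →
      treeCount k L ≤ numSpanningTrees G := by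
  intro k L φ hk hL h
  induction hm : G.edgeSet.ncard - L.length using Nat.strong_induction_on generalizing k L φ with
  | _ m ih =>
    by_cases hs : ∀ x, ∃ i < k, φ i = x
    · by_cases hc : ∀ a b, a < b → b < k → G.Adj (φ a) (φ b) → (a, b) ∈ L
      · conv_rhs => rw [h.eq_listGraph hs hc]
        exact (numSpanningTrees_listGraph h.injOn hs hL hk).ge
      · push Not at hc
        obtain ⟨a, b, hab, hb, hadj, hnot⟩ := hc
        have hL' := hL.cons hnot hab hb
        have h' := h.cons hadj
        have hlen := h'.length_le hL'
        rw [List.length_cons] at hlen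
        have := ih _ (by rw [List.length_cons]; omega) hk hL' h' rfl
        rw [treeCount_cons L hab hb] at this
        omega
    · obtain ⟨u, hu, x, hx, hux⟩ := exists_adj_notMem_image hG hk hs
      have hL' := hL.pendant hu
      have h' := h.pendant hL hu hx hux
      have hlen := h'.length_le hL'
      rw [List.length_cons] at hlen
      have := ih _ (by rw [List.length_cons]; omega) k.succ_pos hL' h' rfl
      rwa [treeCount_pendant hL hu] at this

end Embedding

-- Soundness of the search

lemma mem_allPairs {k a b : ℕ} : (a, b) ∈ allPairs k ↔ a < b ∧ b < k := by
  simp [allPairs]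
  omega

lemma nodup_allPairs (k : ℕ) : (allPairs k).Nodup := by
  rw [allPairs, List.nodup_flatMap]
  refine ⟨fun v _ => List.nodup_range.map fun a b h => (Prod.ext_iff.1 h).1, ?_⟩
  refine List.nodup_range.imp fun {v w} hvw => ?_
  rw [Function.onFun, List.disjoint_left]
  rintro e he he'
  simp only [List.mem_map] at he he'
  obtain ⟨_, _, rfl⟩ := he
  obtain ⟨_, _, h⟩ := he'
  exact hvw (Prod.ext_iff.1 h).2.symm

lemma ValidEdges.perm {k : ℕ} {L L' : List (ℕ × ℕ)} (h : ValidEdges k L) (hp : L.Perm L') :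
    ValidEdges k L' :=
  ⟨hp.nodup_iff.1 h.nodup, fun e he => h.lt e (hp.mem_iff.2 he)⟩

lemma ValidEdges.of_append_right {k : ℕ} {L L' : List (ℕ × ℕ)} (h : ValidEdges k (L' ++ L)) :
    ValidEdges k L :=
  ⟨h.nodup.of_append_right, fun e he => h.lt e (List.mem_append_right _ he)⟩

/-- The test shared by all branches: `d` is the computed count, `T` the true count of the current
graph, and `τ` that of the full graph. -/
lemma search_branch {N d T τ : ℕ} {b : Bool}
    (h : (Nat.ble (N + 1) d || (!Nat.beq d N && b)) = true) (hd : d ≤ T)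
    (hd' : d ≤ N → d = T) (hT : T ≤ τ) : τ ≠ N ∨ (d = T ∧ d ≤ N ∧ d ≠ N ∧ b = true) := by
  rw [Bool.or_eq_true, Bool.and_eq_true, Bool.not_eq_true', Nat.ble_eq,
    ← Bool.not_eq_true, Nat.beq_eq] at h
  rcases h with h | ⟨h, hb⟩
  · left; omega
  · rcases le_or_gt d N with hdN | hdN
    · exact .inr ⟨hd' hdN, hdN, h, hb⟩
    · left; omega

section Search

variable {V : Type*} [Finite V] {G : SimpleGraph V}

/-- Each pair in `C` is resolved as an edge or non-edge of `G`; the invariant is that all edges of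
`G` lie in `C ++ L`. -/
lemma chordSearch_sound (hG : G.Connected) {N k : ℕ} (hk : 0 < k) (hk8 : k ≤ 8) {φ : ℕ → V}
    (hs : ∀ x, ∃ i < k, φ i = x) (C : List (ℕ × ℕ)) :
    ∀ {L : List (ℕ × ℕ)} {t : ℕ}, chordSearch N k C L t = true → ValidEdges k (C ++ L) →
      EmbedsEdges G k L φ → t = treeCount k L → t ≤ N → t ≠ N →
      (∀ a b, a < b → b < k → G.Adj (φ a) (φ b) → (a, b) ∈ C ++ L) → numSpanningTrees G ≠ N := by
  induction C with
  | nil =>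
    intro L t _ hL h ht _ htN hc
    rw [List.nil_append] at hL
    rw [h.eq_listGraph hs hc, numSpanningTrees_listGraph h.injOn hs hL hk, ← ht]
    exact htN
  | cons e C ih =>
    intro L t hsearch hL h ht htle htN hc
    rw [chordSearch, Bool.and_eq_true] at hsearch
    by_cases hadj : G.Adj (φ e.1) (φ e.2)
    · have hL' : ValidEdges k (C ++ e :: L) := hL.perm List.perm_middle.symm
      have h' := h.cons hadj
      have h12 := hL.lt e List.mem_cons_self
      have hglue := cappedGlue_spec (N - t) hk8 (ValidEdges.of_append_right hL)
        (h12.1.trans h12.2) h12.2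
      have hT : treeCount k (e :: L) = treeCount k L + glueCount k L e.1 e.2 :=
        treeCount_cons L h12.1 h12.2
      rcases search_branch hsearch.2 (T := treeCount k (e :: L)) (by omega) (by omega)
        (h'.treeCount_le hG hk hL'.of_append_right) with hne | ⟨hd, hdN, hdN', hb⟩
      · exact hne
      · refine ih hb hL' h' hd hdN hdN' fun a b hab hb hadj => ?_
        exact List.perm_middle.mem_iff.2 (hc a b hab hb hadj)
    · refine ih hsearch.1 hL.tail h ht htle htN fun a b hab hb hadj' => ?_
      rcases List.mem_cons.1 (hc a b hab hb hadj') with rfl | hmem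
      exacts [absurd hadj' hadj, hmem]

lemma fillSearch_sound (hG : G.Connected) {N k : ℕ} (hk : 0 < k) (hk8 : k ≤ 8) {φ : ℕ → V}
    (hs : ∀ x, ∃ i < k, φ i = x) {L : List (ℕ × ℕ)} {t : ℕ} (h : fillSearch N k L t = true)
    (hL : ValidEdges k L) (hφ : EmbedsEdges G k L φ) (ht : t = treeCount k L) (htle : t ≤ N)
    (htN : t ≠ N) : numSpanningTrees G ≠ N := by
  refine chordSearch_sound hG hk hk8 hs _ h ⟨?_, ?_⟩ hφ ht htle htN ?_
  · refine List.Nodup.append ((nodup_allPairs k).filter _) hL.nodup ?_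
    rw [List.disjoint_left]
    intro e he
    simpa using (List.mem_filter.1 he).2
  · intro e he
    rcases List.mem_append.1 he with he | he
    · exact mem_allPairs.1 (List.mem_filter.1 he).1
    · exact hL.lt e he
  · intro a b hab hb _
    by_cases hmem : (a, b) ∈ L
    · exact List.mem_append_right _ hmem
    · exact List.mem_append_left _ (List.mem_filter.2 ⟨mem_allPairs.2 ⟨hab, hb⟩, by simpa using hmem⟩)

/-- `ds` bounds the numbers `glueCount k L p y` from below, sharply where this matters. -/
def GlueBounds (N k : ℕ) (L : List (ℕ × ℕ)) (t p : ℕ) (ds : List ℕ) : Prop :=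
  ds.length = k ∧ ∀ y < k, ds.getD y 0 ≤ glueCount k L p y ∧
    (2 * t + ds.getD y 0 ≤ N → ds.getD y 0 = glueCount k L p y)

lemma glueBounds_glueList {N k : ℕ} (hk8 : k ≤ 8) {L : List (ℕ × ℕ)} (hL : ValidEdges k L)
    (t : ℕ) {p : ℕ} (hp : p < k) : GlueBounds N k L t p (glueList N k L t p) := by
  refine ⟨by simp [glueList], fun y hy => ?_⟩
  have hget : (glueList N k L t p).getD y 0 =
      bif Nat.ble (N + 1) (2 * t) then 0 else cappedGlue (N - 2 * t) k L p y := by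
    simp [glueList, List.getD_eq_getElem?_getD, hy]
  rw [hget]
  have := cappedGlue_spec (N - 2 * t) hk8 hL hp hy
  cases hb : Nat.ble (N + 1) (2 * t) with
  -- If `2 * t > N`, every closing of the path is pruned anyway, so the trivial bound `0` suffices.
  | true =>
    have := Nat.le_of_ble_eq_true hb
    simp only [cond_true]
    omega
  | false =>
    simp only [cond_false]
    omega

/-- By `glueCount_pendant` the bounds rise by `t` as the tip moves on; the final `0` is the tip
glued to itself. -/
lemma GlueBounds.pendant {N k : ℕ} {L : List (ℕ × ℕ)} (hL : ValidEdges k L) {t p : ℕ}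
    (hp : p < k) (ht : t = treeCount k L) {ds : List ℕ} (h : GlueBounds N k L t p ds) :
    GlueBounds N (k + 1) ((p, k) :: L) t k (ds.map (t + ·) ++ [0]) := by
  refine ⟨by simp [h.1], fun y hy => ?_⟩
  rcases Nat.lt_succ_iff_lt_or_eq.1 hy with hy | rfl
  · have hget : (ds.map (t + ·) ++ [0]).getD y 0 = t + ds.getD y 0 := by
      have := h.1
      simp [List.getD_eq_getElem?_getD, List.getElem?_append, this, hy]
    rw [hget, glueCount_comm (hL.pendant hp), glueCount_pendant hL hp hy]
    have := h.2 y hy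
    omega
  · have hget : (ds.map (t + ·) ++ [0]).getD y 0 = 0 := by
      have := h.1
      simp [List.getD_eq_getElem?_getD, this]
    rw [hget]
    simp [glueCount]

/-- A fixed `G` is followed through the branches that it realises. A path can always continue
because its tip is not a leaf. Vertices below `u₀` have no uncovered neighbours, which avoids
attaching the same paths in several orders. -/
lemma pathSearch_graphSearch_sound (hG : G.Connected)
    (hleaf : ∀ x y, G.Adj x y → ∃ z, z ≠ y ∧ G.Adj x z) {N M : ℕ} (hM : M ≤ 8)
    (hV : Nat.card V ≤ M) (f : ℕ) :
    (∀ {u₀ k p t : ℕ} {L : List (ℕ × ℕ)} {ds : List ℕ} {φ : ℕ → V},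
      pathSearch N M f u₀ k p L t ds = true → u₀ ≤ k → p < k → ValidEdges k L →
      EmbedsEdges G (k + 1) ((p, k) :: L) φ → t = treeCount k L → GlueBounds N k L t p ds →
      (∀ i < u₀, ∀ x, G.Adj (φ i) x → x ∈ φ '' Set.Iio k) → numSpanningTrees G ≠ N) ∧
    (∀ {u₀ k t : ℕ} {L : List (ℕ × ℕ)} {φ : ℕ → V},
      graphSearch N M f u₀ k L t = true → 0 < k → ValidEdges k L →
      EmbedsEdges G k L φ → t = treeCount k L → t ≤ N → t ≠ N →
      (∀ i < u₀, ∀ x, G.Adj (φ i) x → x ∈ φ '' Set.Iio k) → numSpanningTrees G ≠ N) := by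
  induction f with
  -- Without fuel the search answers `false`, so the amount of fuel is irrelevant to soundness.
  | zero =>
    constructor
    · intro _ _ _ _ _ _ _ h
      simp [pathSearch] at h
    · intro _ _ _ _ _ h
      simp [graphSearch] at h
  | succ f ih =>
    constructor
    · intro u₀ k p t L ds φ hsearch hu₀ hp hL h ht hds hout
      rw [pathSearch, Bool.and_eq_true, List.all_eq_true] at hsearch
      have hL1 := hL.pendant hp
      obtain ⟨z, hzp, hz⟩ := hleaf (φ k) (φ p) (h.adj (p, k) List.mem_cons_self).symm
      by_cases hzim : z ∈ φ '' Set.Iio (k + 1)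
      · obtain ⟨y, hy, rfl⟩ := hzim
        have hyk : y < k := lt_of_le_of_ne (Nat.lt_succ_iff.1 hy) fun h => hz.ne (by rw [h])
        have hyu : ¬ y < u₀ := fun hyu => by
          obtain ⟨j, hj, hjk⟩ := hout y hyu _ hz.symm
          have := h.injOn (Set.mem_Iio.2 ((Set.mem_Iio.1 hj).trans k.lt_succ_self))
            (Set.mem_Iio.2 k.lt_succ_self) hjk
          exact (this ▸ Set.mem_Iio.1 hj).false
        have hyp : y ≠ p := fun h => hzp (by rw [h])
        have hb := hsearch.2 y (List.mem_range.2 hyk)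
        rw [Bool.or_eq_true, Bool.or_eq_true] at hb
        have hb' := (hb.resolve_left fun h => hyu (by simpa [Nat.blt] using h)).resolve_left
          fun h => hyp (Nat.eq_of_beq_eq_true h)
        have hmem : (y, k) ∉ (p, k) :: L := by
          rw [List.mem_cons, Prod.mk.injEq]
          rintro (⟨h, -⟩ | h)
          · exact hyp h
          · exact (hL.lt _ h).2.false
        have hL2 := hL1.cons hmem hyk k.lt_succ_self
        have h2 := h.cons hz.symm
        -- Trees using exactly one of the two edges at `k` number `2 * t`; those using both are
        -- counted by gluing `p` to `y`.
        have hT : treeCount (k + 1) ((y, k) :: (p, k) :: L) =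
            2 * treeCount k L + glueCount k L p y := by
          rw [treeCount_cons _ hyk k.lt_succ_self, treeCount_pendant hL hp,
            glueCount_pendant hL hp hyk]
          ring
        have hd := hds.2 y hyk
        rcases search_branch hb' (T := treeCount (k + 1) ((y, k) :: (p, k) :: L))
          (by omega) (by omega) (h2.treeCount_le hG k.succ_pos hL2) with hne | ⟨hd1, hd2, hd3, hd4⟩
        · exact hne
        · refine ih.2 hd4 k.succ_pos hL2 h2 hd1 hd2 hd3 fun i hi x hx => ?_
          exact Set.image_mono (Set.Iio_subset_Iio k.le_succ) (hout i hi x hx)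
      · have h1 := h.pendant hL1 k.lt_succ_self hzim hz
        have hkM : k + 2 ≤ M := h1.card_le.trans hV
        have hs := hsearch.1
        rw [Nat.ble_eq_true_of_le hkM, cond_true] at hs
        refine ih.1 hs (hu₀.trans k.le_succ) k.lt_succ_self hL1 h1
          (ht.trans (treeCount_pendant hL hp).symm) (hds.pendant hL hp ht) fun i hi x hx => ?_
        rw [Function.update_of_ne (by omega)] at hx
        rw [image_congr_update]
        exact Set.image_mono (Set.Iio_subset_Iio k.le_succ) (hout i hi x hx)
    · intro u₀ k t L φ hsearch hk hL h ht htle htN hout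
      rw [graphSearch, Bool.and_eq_true] at hsearch
      have hk8 : k ≤ 8 := h.card_le.trans (hV.trans hM)
      by_cases hs : ∀ x, ∃ i < k, φ i = x
      · exact fillSearch_sound hG hk hk8 hs hsearch.2 hL h ht htle htN
      -- The path is taken to leave at the least vertex with an uncovered neighbour, which then
      -- becomes the new `u₀`.
      · have hex := exists_adj_notMem_image hG hk hs
        classical
        obtain ⟨hu, x, hx, hux⟩ := Nat.find_spec hex
        have hmin := fun i (hi : i < Nat.find hex) => Nat.find_min hex hi
        generalize Nat.find hex = u at hu hux hmin
        have h1 := h.pendant hL hu hx hux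
        have hkM : k + 1 ≤ M := h1.card_le.trans hV
        have hs1 := hsearch.1
        rw [Nat.ble_eq_true_of_le hkM, cond_true, List.all_eq_true] at hs1
        have hb := hs1 u (List.mem_range.2 hu)
        rw [Bool.or_eq_true] at hb
        have hb' := hb.resolve_left fun h =>
          hx (hout u (by simpa [Nat.blt] using h) x hux)
        refine ih.1 hb' hu.le hu hL h1 ht (glueBounds_glueList hk8 hL t hu) fun i hi y hy => ?_
        rw [Function.update_of_ne (by omega)] at hy
        rw [image_congr_update]
        by_contra hcon
        exact hmin i hi ⟨hi.trans hu, y, hcon, hy⟩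

end Search

-- Starting from a cycle and removing leaves

lemma mem_cycleEdges {m : ℕ} {e : ℕ × ℕ} :
    e ∈ cycleEdges m ↔ e = (0, m - 1) ∨ ∃ i, i + 1 < m ∧ e = (i, i + 1) := by
  simp only [cycleEdges, List.mem_cons, List.mem_map, List.mem_range]
  refine or_congr_right (exists_congr fun i => ?_)
  rw [eq_comm (a := e), Nat.lt_sub_iff_add_lt]

lemma validEdges_cycleEdges {m : ℕ} (hm : 3 ≤ m) : ValidEdges m (cycleEdges m) := by
  refine ⟨List.nodup_cons.2 ⟨?_, List.nodup_range.map fun a b h => (Prod.ext_iff.1 h).1⟩, ?_⟩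
  · simp only [List.mem_map, Prod.mk.injEq, not_exists, not_and]
    intro i _ h
    omega
  · intro e he
    rcases mem_cycleEdges.1 he with rfl | ⟨i, hi, rfl⟩ <;> simp <;> omega

section

variable {V : Type*} {G : SimpleGraph V}

open Fin.CommRing in
-- The shift `s` rotates the cycle, so that the vertex where the first path leaves can be numbered
-- `0`.
lemma embedsEdges_cycleEdges {n : ℕ} (f : Copy (cycleGraph (n + 3)) G) (s : ℕ) :
    EmbedsEdges G (n + 3) (cycleEdges (n + 3)) fun i => f ((i + s : ℕ) : Fin (n + 3)) := by
  refine ⟨fun i hi j hj hij => ?_, fun e he => ?_⟩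
  · have h := f.injective hij
    rw [Nat.cast_add, Nat.cast_add, add_left_inj, Fin.ext_iff, Fin.val_natCast, Fin.val_natCast,
      Nat.mod_eq_of_lt hi, Nat.mod_eq_of_lt hj] at h
    exact h
  · refine f.toHom.map_adj (cycleGraph_adj.2 ?_)
    rcases mem_cycleEdges.1 he with rfl | ⟨i, hi, rfl⟩
    · left
      have : ((n + 3 : ℕ) : Fin (n + 3)) = 0 := Fin.natCast_self _
      push_cast at this ⊢
      linear_combination -this
    · right
      push_cast
      ring

open Fin.CommRing in
lemma exists_embedsEdges_cycleEdges [Finite V] (hG : G.Connected) (hcyc : ¬ G.IsAcyclic) :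
    ∃ m φ, 3 ≤ m ∧ EmbedsEdges G m (cycleEdges m) φ ∧
      ((∀ x, ∃ i < m, φ i = x) ∨ ∃ x ∉ φ '' Set.Iio m, G.Adj (φ 0) x) := by
  rw [isAcyclic_iff_free_cycleGraph] at hcyc
  push Not at hcyc
  obtain ⟨m, hm, hfree⟩ := hcyc
  obtain ⟨n, rfl⟩ := Nat.exists_eq_add_of_le' hm
  obtain ⟨f⟩ := hfree
  have h0 := embedsEdges_cycleEdges f 0
  by_cases hs : ∀ x, ∃ i < n + 3, f ((i + 0 : ℕ) : Fin (n + 3)) = x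
  · exact ⟨n + 3, _, hm, h0, .inl hs⟩
  · obtain ⟨u, hu, x, hx, hux⟩ := exists_adj_notMem_image hG (by omega) hs
    refine ⟨n + 3, _, hm, embedsEdges_cycleEdges f u, .inr ⟨x, ?_, ?_⟩⟩
    · rintro ⟨i, -, rfl⟩
      refine hx ⟨(i + u) % (n + 3), Nat.mod_lt _ (by omega), ?_⟩
      refine congrArg f (Fin.ext ?_)
      rw [add_zero, Fin.val_natCast, Fin.val_natCast, Nat.mod_mod]
    · simpa using hux

lemma numSpanningTrees_eq_one_of_isTree [Finite V] (hG : G.IsTree) : numSpanningTrees G = 1 := by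
  have := hG.connected.nonempty
  rw [numSpanningTrees, Set.ncard_eq_one]
  refine ⟨G, Set.ext fun T => ⟨fun ⟨hle, hT⟩ => ?_, ?_⟩⟩
  · have h1 := (isTree_iff_isAcyclic_and_ncard.1 hG).2
    have h2 := (isTree_iff_isAcyclic_and_ncard.1 hT).2
    exact (eq_of_le_of_ncard_le hle (by omega)).symm
  · rintro rfl
    exact ⟨le_rfl, hG⟩

lemma connected_of_numSpanningTrees_ne_zero (h : numSpanningTrees G ≠ 0) : G.Connected := by
  obtain ⟨T, hT, hT'⟩ := Set.nonempty_of_ncard_ne_zero h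
  exact hT'.connected.mono hT

lemma cycleSearch_sound [Finite V] (hG : G.Connected)
    (hleaf : ∀ x y, G.Adj x y → ∃ z, z ≠ y ∧ G.Adj x z) {N M f : ℕ} (hM : M ≤ 8)
    (hV : Nat.card V ≤ M) (hN : N ≠ 1) (hsearch : fullSearch N M f = true) :
    numSpanningTrees G ≠ N := by
  by_cases hac : G.IsAcyclic
  · rw [numSpanningTrees_eq_one_of_isTree ⟨hG, hac⟩]
    exact hN.symm
  obtain ⟨m, φ, hm, h, hφ⟩ := exists_embedsEdges_cycleEdges hG hac
  have hL := validEdges_cycleEdges hm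
  have hmM : m ≤ M := h.card_le.trans hV
  have hm0 : 0 < m := by omega
  rw [fullSearch, List.all_eq_true] at hsearch
  have hs := hsearch m (List.mem_range.2 (by omega))
  rw [Bool.or_eq_true] at hs
  have hs' := hs.resolve_left (by simpa [Nat.blt] using hm)
  have hcount := cappedCount_spec N (hL.mono (hmM.trans hM)) (m - 1) 0 codesLabels_discreteBits
  rw [zero_add] at hcount
  rcases search_branch hs' hcount.1 hcount.2 (h.treeCount_le hG hm0 hL) with
    hne | ⟨ht, htle, htN, hb⟩
  · exact hne
  rw [Bool.and_eq_true] at hb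
  rcases hφ with hsurj | ⟨x, hx, h0x⟩
  · exact fillSearch_sound hG hm0 (hmM.trans hM) hsurj hb.2 hL h ht htle htN
  · have h1 := h.pendant hL hm0 hx h0x
    have hb1 := hb.1
    rw [Nat.ble_eq_true_of_le (h1.card_le.trans hV), cond_true] at hb1
    exact (pathSearch_graphSearch_sound hG hleaf hM hV f).1 hb1 (Nat.zero_le _) hm0 hL h1 ht
      (glueBounds_glueList (hmM.trans hM) hL _ hm0) fun i hi => absurd hi (Nat.not_lt_zero i)

/-- Deleting a leaf does not change the number of spanning trees. -/
lemma numSpanningTrees_induce_compl_leaf [Finite V] {x y : V} (hxy : G.Adj x y)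
    (hx : ∀ z, G.Adj x z → z = y) :
    numSpanningTrees (G.induce {x}ᶜ) = numSpanningTrees G := by
  let ι : ({x}ᶜ : Set V) ↪ V := Function.Embedding.subtype _
  -- Reattaching the leaf edge gives a bijection between the spanning trees of the two graphs.
  let ext : SimpleGraph ({x}ᶜ : Set V) → SimpleGraph V := fun T => T.map ι ⊔ edge x y
  have hyx : y ∈ ({x}ᶜ : Set V) := hxy.ne'
  have : Nonempty ({x}ᶜ : Set V) := ⟨⟨y, hyx⟩⟩
  have : Nonempty V := ⟨x⟩
  have hadj : ∀ T (u v : ({x}ᶜ : Set V)), (ext T).Adj u v ↔ T.Adj u v := by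
    intro T u v
    have hu : (u : V) ≠ x := u.2
    have hv : (v : V) ≠ x := v.2
    have : (T.map ι).Adj u v ↔ T.Adj u v := map_adj_apply (f := ι)
    simp [ext, this, edge_adj, hu, hv]
  have hnot : ∀ (T : SimpleGraph ({x}ᶜ : Set V)) (v : V), ¬ (T.map ι).Adj x v := by
    rintro T v ⟨-, a, b, -, ha, -⟩
    exact a.2 ha
  have hinj : Function.Injective ext := fun T T' h => by
    ext u v
    rw [← hadj T, h, hadj T']
  have hcard : Nat.card ({x}ᶜ : Set V) + 1 = Nat.card V := by
    have := Set.ncard_add_ncard_compl ({x} : Set V)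
    rw [Set.ncard_singleton] at this
    rw [Nat.card_coe_set_eq]
    omega
  have hcount : ∀ T, (ext T).edgeSet.ncard = T.edgeSet.ncard + 1 := by
    intro T
    rw [ncard_edgeSet_sup_edge hxy.ne (hnot T y), edgeSet_map,
      Set.ncard_image_of_injective _ ι.sym2Map.injective]
  have himage : {T | T ≤ G ∧ T.IsTree} =
      ext '' {T | T ≤ G.induce {x}ᶜ ∧ T.IsTree} := by
    ext T
    constructor
    · rintro ⟨hle, hT⟩
      have hTxy : T.Adj x y := by
        have : Nontrivial V := ⟨x, y, hxy.ne⟩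
        obtain ⟨z, hz⟩ := hT.connected.preconnected.exists_adj_of_nontrivial x
        exact hx z (hle hz) ▸ hz
      have hext : ext (T.induce {x}ᶜ) = T := by
        ext u v
        by_cases hu : u = x
        · subst hu
          have : T.Adj u v ↔ v = y := ⟨fun h => hx v (hle h), fun h => h ▸ hTxy⟩
          rw [sup_adj, this, edge_adj]
          have := hnot (T.induce {u}ᶜ) v
          have := hxy.ne
          grind
        · by_cases hv : v = x
          · subst hv
            have : T.Adj u v ↔ u = y := ⟨fun h => hx u (hle h).symm, fun h => h ▸ hTxy.symm⟩
            rw [sup_adj, this, edge_adj]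
            have := fun h => hnot (T.induce {v}ᶜ) u (SimpleGraph.Adj.symm h)
            have := hxy.ne
            grind
          · exact hadj _ ⟨u, hu⟩ ⟨v, hv⟩
      refine ⟨T.induce {x}ᶜ, ⟨fun u v h => hle h, ?_⟩, hext⟩
      rw [isTree_iff_isAcyclic_and_ncard]
      refine ⟨hT.isAcyclic.induce _, ?_⟩
      have h1 := hcount (T.induce {x}ᶜ)
      have h2 := (isTree_iff_isAcyclic_and_ncard.1 hT).2
      rw [hext] at h1
      omega
    · rintro ⟨T, ⟨hle, hT⟩, rfl⟩
      refine ⟨sup_le ?_ ((edge_le_iff _).2 (.inr hxy)), ?_⟩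
      · rintro u v ⟨-, a, b, hab, rfl, rfl⟩
        exact hle hab
      · rw [isTree_iff_connected_and_card]
        refine ⟨(connected_iff_exists_forall_reachable _).2 ⟨y, fun v => ?_⟩, ?_⟩
        · by_cases hv : v = x
          · subst hv
            exact Adj.reachable (by simp [ext, edge_adj, hxy.ne'])
          · exact ((hT.connected.preconnected ⟨y, hyx⟩ ⟨v, hv⟩).map
              (Embedding.map ι T).toHom).mono le_sup_left
        · have h2 := (isTree_iff_isAcyclic_and_ncard.1 hT).2
          rw [Nat.card_coe_set_eq, hcount]
          omega
  unfold numSpanningTrees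
  rw [himage, Set.ncard_image_of_injective _ hinj]

end

/-- Leaves are removed until none is left; `2 ≤ N` excludes disconnected graphs and trees. -/
theorem numSpanningTrees_ne_of_fullSearch {N M f : ℕ} (hM : M ≤ 8) (hN : 2 ≤ N)
    (hsearch : fullSearch N M f = true) {V : Type*} [Finite V] (G : SimpleGraph V)
    (hV : Nat.card V ≤ M) : numSpanningTrees G ≠ N := by
  induction hn : Nat.card V using Nat.strong_induction_on generalizing V with
  | _ n ih =>
    intro hG
    by_cases hleaf : ∀ x y, G.Adj x y → ∃ z, z ≠ y ∧ G.Adj x z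
    · exact cycleSearch_sound (connected_of_numSpanningTrees_ne_zero (by omega)) hleaf hM hV
        (by omega) hsearch hG
    · push Not at hleaf
      obtain ⟨x, y, hxy, hx⟩ := hleaf
      have hlt : Nat.card ({x}ᶜ : Set V) < Nat.card V := by
        have := Set.ncard_add_ncard_compl ({x} : Set V)
        rw [Set.ncard_singleton] at this
        rw [Nat.card_coe_set_eq]
        omega
      refine ih _ (hn ▸ hlt) (G.induce {x}ᶜ) (hlt.le.trans hV) rfl ?_
      rw [numSpanningTrees_induce_compl_leaf hxy fun z hz => by_contra fun h => hx z h hz, hG]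

-- Bounds on `alpha` and `beta`

/-- The graph on `Fin (k + 1)` with edge list `L`. -/
def finGraph (k : ℕ) (L : List (ℕ × ℕ)) : SimpleGraph (Fin (k + 1)) :=
  listGraph (Fin.ofNat (k + 1)) L

lemma injOn_ofNat (k : ℕ) : Set.InjOn (Fin.ofNat (k + 1)) (Set.Iio (k + 1)) := by
  intro i hi j hj h
  simpa [Fin.ext_iff, Nat.mod_eq_of_lt (Set.mem_Iio.1 hi), Nat.mod_eq_of_lt (Set.mem_Iio.1 hj)]
    using h

lemma numSpanningTrees_finGraph {k : ℕ} {L : List (ℕ × ℕ)} (hL : ValidEdges (k + 1) L) :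
    numSpanningTrees (finGraph k L) = treeCount (k + 1) L :=
  numSpanningTrees_listGraph (injOn_ofNat k)
    (fun x => ⟨x, x.2, Fin.ext (Nat.mod_eq_of_lt x.2)⟩) hL k.succ_pos

lemma alpha_le {n k : ℕ} {L : List (ℕ × ℕ)} (hn : L.Nodup)
    (hlt : ∀ e ∈ L, e.1 < e.2 ∧ e.2 < k + 1) (h : treeCount (k + 1) L = n) :
    alpha n ≤ (k + 1 : ℕ) :=
  sInf_le ⟨k + 1, finGraph k L, (numSpanningTrees_finGraph ⟨hn, hlt⟩).trans h, rfl⟩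

lemma beta_le {n k : ℕ} {L : List (ℕ × ℕ)} (hn : L.Nodup)
    (hlt : ∀ e ∈ L, e.1 < e.2 ∧ e.2 < k + 1) (h : treeCount (k + 1) L = n) :
    beta n ≤ (L.length : ℕ) :=
  sInf_le ⟨k + 1, finGraph k L, (numSpanningTrees_finGraph ⟨hn, hlt⟩).trans h, by
    rw [finGraph, ncard_edgeSet_listGraph (injOn_ofNat k) ⟨hn, hlt⟩]⟩

lemma le_alpha_of_fullSearch {N M f : ℕ} (hM : M ≤ 8) (hN : 2 ≤ N)
    (hsearch : fullSearch N M f = true) : (M + 1 : ℕ) ≤ alpha N := by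
  refine le_sInf ?_
  rintro κ ⟨k, G, hG, rfl⟩
  rw [Nat.cast_le]
  by_contra! hlt
  exact numSpanningTrees_ne_of_fullSearch hM hN hsearch G
    (by rw [Nat.card_eq_fintype_card, Fintype.card_fin]; omega) hG

lemma numSpanningTrees_le_choose {V : Type*} [Finite V] (G : SimpleGraph V) :
    numSpanningTrees G ≤ G.edgeSet.ncard.choose (Nat.card V - 1) := by
  have hle : numSpanningTrees G ≤ (((Set.toFinite G.edgeSet).toFinset.powersetCard
      (Nat.card V - 1) : Finset (Finset (Sym2 V))) : Set (Finset (Sym2 V))).ncard := by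
    refine Set.ncard_le_ncard_of_injOn (fun T => (Set.toFinite T.edgeSet).toFinset)
      (fun T hT => ?_) (fun T _ T' _ h => ?_) (Set.toFinite _)
    · have := hT.2.connected.nonempty
      have := (isTree_iff_isAcyclic_and_ncard.1 hT.2).2
      rw [Finset.mem_coe, Finset.mem_powersetCard, Set.Finite.toFinset_subset_toFinset,
        ← Set.ncard_eq_toFinset_card]
      exact ⟨edgeSet_mono hT.1, by omega⟩
    · exact edgeSet_injective (Set.Finite.toFinset_inj.1 h)
  rwa [Set.ncard_coe_finset, Finset.card_powersetCard, ← Set.ncard_eq_toFinset_card] at hle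

/-- With at most five edges, five vertices allow at most `5.choose 4 = 5` trees, six at most one,
and more none. -/
lemma six_le_beta_nine : 6 ≤ beta 9 := by
  refine le_sInf ?_
  rintro κ ⟨v, G, hG, rfl⟩
  by_contra! hlt
  have hlt' : G.edgeSet.ncard < 6 := by exact_mod_cast hlt
  have hcard : Nat.card (Fin v) = v := by simp
  have hv : 5 ≤ v := by
    by_contra! hv
    exact numSpanningTrees_ne_of_fullSearch (N := 9) (M := 4) (f := 20) (by norm_num)
      (by norm_num) (by decide +kernel) G (by omega) hG
  have h := numSpanningTrees_le_choose G
  rw [hG, hcard] at h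
  have h5 := h.trans (Nat.choose_le_choose (v - 1) (show G.edgeSet.ncard ≤ 5 by omega))
  rcases (show v = 5 ∨ v = 6 ∨ 5 < v - 1 by omega) with rfl | rfl | h6
  · exact absurd h5 (by decide)
  · exact absurd h5 (by decide)
  · rw [Nat.choose_eq_zero_of_lt h6] at h5
    omega

theorem mainTheorem3 :
    beta 9 = 6 ∧ alpha 18 = 8 ∧ alpha 25 = 9 ∧ beta 37 ≤ 9 ∧ beta 58 ≤ 10 ∧ beta 30 ≤ 8 := by
  refine ⟨le_antisymm ?_ six_le_beta_nine, le_antisymm ?_ ?_, le_antisymm ?_ ?_, ?_, ?_, ?_⟩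
  -- Two triangles sharing a vertex: `3 * 3` trees.
  · exact beta_le (k := 4) (L := [(0, 1), (0, 2), (1, 2), (0, 3), (0, 4), (3, 4)])
      (by decide) (by decide) (by decide +kernel)
  -- A triangle and a hexagon sharing a vertex: `3 * 6` trees.
  · exact alpha_le (k := 7)
      (L := [(0, 1), (0, 2), (1, 2), (0, 3), (3, 4), (4, 5), (5, 6), (6, 7), (0, 7)])
      (by decide) (by decide) (by decide +kernel)
  · exact le_alpha_of_fullSearch (M := 7) (f := 20) (by norm_num) (by norm_num)
      (by decide +kernel)
  -- Two pentagons sharing a vertex: `5 * 5` trees.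
  · exact alpha_le (k := 8)
      (L := [(0, 1), (1, 2), (2, 3), (3, 4), (0, 4), (0, 5), (5, 6), (6, 7), (7, 8), (0, 8)])
      (by decide) (by decide) (by decide +kernel)
  · exact le_alpha_of_fullSearch (M := 8) (f := 20) (by norm_num) (by norm_num)
      (by decide +kernel)
  · exact beta_le (k := 6)
      (L := [(0, 1), (0, 2), (1, 2), (1, 3), (0, 4), (1, 5), (2, 5), (3, 6), (4, 6)])
      (by decide) (by decide) (by decide +kernel)
  · exact beta_le (k := 7)
      (L := [(0, 3), (0, 7), (1, 3), (1, 6), (2, 5), (2, 6), (3, 6), (4, 6), (4, 7), (5, 7)])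
      (by decide) (by decide) (by decide +kernel)
  · exact beta_le (k := 5)
      (L := [(0, 2), (0, 4), (0, 5), (1, 3), (1, 4), (2, 3), (2, 5), (3, 4)])
      (by decide) (by decide) (by decide +kernel)
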